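/- Let $s,k\ge 1$ and $P\ge 1$ be integers. For $\mathbf h=(h_1,\dots,h_k)\in\mathbb Z^k$, let $U_{s,k}(P;\mathbf h)$ denote the number of integral solutions $(x_1,\dots,x_s)$ of the system \[ \sum_{i=1}^{s}x_i^{2j-1}=h_j\quad (1\leqslant j\leqslant k),\qquad |x_i|\leqslant P\quad (1\leqslant i\leqslant s). \] **Theorem.** Let $k\ge 2$, and let $P$ be large enough in terms of $k$. Suppose that $\mathbf h\in\mathbb Z^k\setminus\{\mathbf 0\}$ is such that, for some natural number $r$, there exist integers $a_1,\dots,a_r$ with $|a_i|\leqslant P$ $(1\leqslant i\leqslant r)$ satisfying \[ h_j=a_1^{2j-1}+\dots+a_r^{2j-1}\quad (1\leqslant j\leqslant k), \] let $r_0(\mathbf h)=r_0(\mathbf h;P)$ be the smallest such $r$, and write \[ \tau(k;\mathbf h)=\left\lfloor\frac{k+1-r_0(\mathbf h)}{2}\right\rfloor . \] Then for every $\varepsilon>0$ one has \[ U_{k+1,k}(P;\mathbf h)\ll P^{\tau(k;\mathbf h)+\varepsilon}, \] where the implied constant depends at most on $k$ and $\varepsilon$ (and not on $P$ or $\mathbf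 h$). If moreover $r_0(\mathbf h)\leqslant k+1$, then \[ P^{\tau(k;\mathbf h)}\leqslant U_{k+1,k}(P;\mathbf h). \] -/

import Mathlib

/-- `IsOddPowerSum P h a`: the integers `a i` satisfy `|a i| ≤ P` and solve the system
`∑ i, (a i) ^ (2 j - 1) = h_j` for `1 ≤ j ≤ k`.  The index `j : Fin k` runs over `0, …, k - 1`,
so that the exponent `2 j - 1` with `1 ≤ j ≤ k` is `2 * j + 1` here. -/
def IsOddPowerSum {k s : ℕ} (P : ℕ) (h : Fin k → ℤ) (a : Fin s → ℤ) : Prop :=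
  (∀ i, |a i| ≤ (P : ℤ)) ∧ ∀ j : Fin k, ∑ i, a i ^ (2 * (j : ℕ) + 1) = h j

noncomputable instance {k s : ℕ} (P : ℕ) (h : Fin k → ℤ) (a : Fin s → ℤ) : Decidable (IsOddPowerSum P h a) :=
  inferInstanceAs (Decidable (_ ∧ _))

/-- `U_{s,k}(P; h)`: the number of integral solutions `x`, with `|x i| ≤ P` for all `i`, of the
system `∑_{i=1}^s (x i) ^ (2 j - 1) = h_j` (`1 ≤ j ≤ k`). -/
noncomputable def countU (s k P : ℕ) (h : Fin k → ℤ) : ℕ :=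
  ((Fintype.piFinset fun _ : Fin s => Finset.Icc (-(P : ℤ)) (P : ℤ)).filter
    fun x => IsOddPowerSum P h x).card

/-- `h` is a sum of `r` odd-power tuples: some integers `a_1, …, a_r` with `|a_i| ≤ P` satisfy
`h_j = a_1 ^ (2 j - 1) + … + a_r ^ (2 j - 1)` for `1 ≤ j ≤ k`. -/
def HasRep {k : ℕ} (P : ℕ) (h : Fin k → ℤ) (r : ℕ) : Prop :=
  ∃ a : Fin r → ℤ, IsOddPowerSum P h a

/-- `r₀(h)`, which depends on `P` as well: the least `r` such that `h` is a sum of `r` odd-power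
tuples.  Meaningful when such an `r` exists. -/
noncomputable def rZero {k : ℕ} (P : ℕ) (h : Fin k → ℤ) : ℕ :=
  sInf {r : ℕ | HasRep P h r}

/-- `τ(k; h) = ⌊(k + 1 - r₀(h)) / 2⌋`, an integer. -/
noncomputable def tauExp {k : ℕ} (P : ℕ) (h : Fin k → ℤ) : ℤ :=
  ⌊((k : ℚ) + 1 - (rZero P h : ℚ)) / 2⌋

/-! Call a solution noncancelling if no two entries at distinct positions sum to zero. Removing a
cancelling pair costs a factor O(P) and two variables, and this can go on only while at least r₀
variables remain. So everything rests on bounding the noncancelling solutions in n ≤ k + 1 variables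
by O(P^ε) (`exists_card_noncancelU_le`). Fix one such y, let x be another, and put F(t) = ∏(t +
x_i)(t - y_i). By Newton's identities the equations kill the odd coefficients of F, except possibly
that of t, say c, when n = k + 1. Then F(t) - F(-t) = 2ct, and t = x_i gives ∏_{j≠i}(x_i + x_j)
∏_j(x_i - y_j) = c; exchanging x and y gives -c. If c = 0, each x_i is some y_j. Otherwise,
multiplying over i and cancelling the common product of differences shows that ∏(x_i + x_j) is, up
to sign, the same product for y. Each x_i + x_j thus divides a fixed nonzero integer of size P^O(1),
and the divisor bound applies. For the lower bound, insert pairs a, -a into a short solution. -/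

/-! ### Odd power sums and the polynomial ∏(X + x_i)(X - y_i) -/

open Finset Polynomial in
/-- If the first `m` odd power sums of a finite family of integers vanish, then so do its first `m`
elementary symmetric functions of odd degree. -/
theorem esymm_odd_eq_zero {σ : Type*} [Fintype σ] (z : σ → ℤ) (m : ℕ)
    (hz : ∀ j < m, ∑ i, z i ^ (2 * j + 1) = 0) :
    ∀ j < m, (univ.val.map z).esymm (2 * j + 1) = 0 := by
  intro j
  induction j using Nat.strong_induction_on with
  | _ j ih =>
  intro hj
  have h := congrArg (MvPolynomial.aeval z) (MvPolynomial.mul_esymm_eq_sum σ ℤ (2 * j + 1))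
  simp only [map_mul, map_natCast, map_pow, map_neg, map_one, map_sum,
    MvPolynomial.aeval_esymm_eq_multiset_esymm, MvPolynomial.psum, MvPolynomial.aeval_X] at h
  rw [Finset.sum_eq_zero] at h
  · rw [mul_zero] at h
    exact (mul_eq_zero.mp h).resolve_left (by positivity)
  · rintro ⟨a, b⟩ hab
    simp only [mem_filter, HasAntidiagonal.mem_antidiagonal] at hab
    obtain ⟨hab, ha⟩ := hab
    rcases Nat.even_or_odd' b with ⟨c, rfl | rfl⟩
    · obtain ⟨d, rfl⟩ : ∃ d, a = 2 * d + 1 := ⟨j - c, by omega⟩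
      rw [ih d (by omega) (by omega)]
      ring
    · rw [hz c (by omega), mul_zero]

open Finset Polynomial in
/-- The polynomial with roots `-x i` and `y i`. -/
noncomputable def oppositePoly {n : ℕ} (x y : Fin n → ℤ) : ℤ[X] :=
  (∏ i, (X + C (x i))) * ∏ i, (X - C (y i))

-- Up to order, the coefficient is the elementary symmetric function of degree 2(n - 1 - j) + 1 in
-- the x_i and -y_i, whose odd power sums vanish by hypothesis.
open Finset Polynomial in
theorem oppositePoly_coeff_odd {n m : ℕ} (x y : Fin n → ℤ)
    (h : ∀ j < m, ∑ i, x i ^ (2 * j + 1) = ∑ i, y i ^ (2 * j + 1)) {j : ℕ}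
    (hjn : j < n) (hj : n - 1 - j < m) : (oppositePoly x y).coeff (2 * j + 1) = 0 := by
  have hg : oppositePoly x y =
      ((univ : Finset (Fin n ⊕ Fin n)).val.map
        fun i => X + C (Sum.elim x (fun i => - y i) i)).prod := by
    change _ = ∏ i : Fin n ⊕ Fin n, (X + C (Sum.elim x (fun i => - y i) i))
    rw [Fintype.prod_sum_type]
    simp [oppositePoly, sub_eq_add_neg]
  have hcard : Multiset.card (univ : Finset (Fin n ⊕ Fin n)).val = 2 * n := by
    simp [two_mul]
  rw [hg, Multiset.prod_X_add_C_coeff' _ _ (by rw [hcard]; omega), hcard,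
    show 2 * n - (2 * j + 1) = 2 * (n - 1 - j) + 1 by omega]
  refine esymm_odd_eq_zero _ m (fun j hj => ?_) _ hj
  rw [Fintype.sum_sum_type]
  simp [h j hj, (odd_two_mul_add_one j).neg_pow]

open Polynomial in
theorem coeff_comp_neg_X (p : ℤ[X]) (d : ℕ) : (p.comp (-X)).coeff d = p.coeff d * (-1) ^ d := by
  rw [show (-X : ℤ[X]) = C (-1) * X by simp, comp_C_mul_X_coeff]

open Finset Polynomial in
theorem oppositePoly_sub_comp_neg {n : ℕ} (x y : Fin n → ℤ)
    (h : ∀ j < n - 1, ∑ i, x i ^ (2 * j + 1) = ∑ i, y i ^ (2 * j + 1)) :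
    oppositePoly x y - (oppositePoly x y).comp (-X) = C (2 * (oppositePoly x y).coeff 1) * X := by
  have hdeg : (oppositePoly x y).natDegree ≤ 2 * n := by
    unfold oppositePoly
    refine natDegree_mul_le.trans ?_
    have h1 := natDegree_prod_le (univ : Finset (Fin n)) (fun i => X + C (x i))
    have h2 := natDegree_prod_le (univ : Finset (Fin n)) (fun i => X - C (y i))
    simp only [natDegree_X_add_C, natDegree_X_sub_C, sum_const, card_univ, Fintype.card_fin,
      smul_eq_mul, mul_one] at h1 h2
    omega
  ext d
  rw [coeff_sub, coeff_comp_neg_X, coeff_C_mul, coeff_X]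
  rcases Nat.even_or_odd' d with ⟨c, rfl | rfl⟩
  · rw [if_neg (by omega)]
    simp
  · rcases Nat.eq_zero_or_pos c with rfl | hc
    · simp
      ring
    · rw [if_neg (by omega)]
      by_cases hcn : c < n
      · rw [oppositePoly_coeff_odd x y h hcn (by omega)]
        simp
      · rw [coeff_eq_zero_of_natDegree_lt (by omega)]
        simp

open Finset Polynomial in
theorem prod_add_mul_prod_sub_eq_coeff {n : ℕ} (x y : Fin n → ℤ)
    (h : ∀ j < n - 1, ∑ i, x i ^ (2 * j + 1) = ∑ i, y i ^ (2 * j + 1)) (i : Fin n) :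
    (∏ j ∈ univ.erase i, (x i + x j)) * ∏ j, (x i - y j) = (oppositePoly x y).coeff 1 := by
  have hfac : oppositePoly x y = (X + C (x i)) *
      ((∏ j ∈ univ.erase i, (X + C (x j))) * ∏ j, (X - C (y j))) := by
    rw [oppositePoly, ← Finset.mul_prod_erase univ (fun j => X + C (x j)) (mem_univ i), mul_assoc]
  -- Evaluating at `x i` leaves a factor 2 x_i to cancel. If it is zero, X divides the polynomial
  -- and the coefficient is read off directly.
  by_cases hx : x i = 0
  · rw [hfac, hx, C_0, add_zero, coeff_X_mul, coeff_zero_eq_eval_zero]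
    simp [eval_prod]
  · have he := congrArg (eval (x i)) (oppositePoly_sub_comp_neg x y h)
    rw [eval_sub, eval_comp, eval_mul, eval_C, eval_X] at he
    nth_rewrite 1 2 [hfac] at he
    simp only [eval_mul, eval_add, eval_X, eval_C, eval_neg, eval_prod, eval_sub,
      neg_add_cancel, zero_mul, sub_zero] at he
    refine mul_left_cancel₀ (mul_ne_zero two_ne_zero hx) ?_
    linear_combination he

open Finset Polynomial in
theorem oppositePoly_coeff_one_swap {n : ℕ} (x y : Fin n → ℤ) :
    (oppositePoly y x).coeff 1 = -(oppositePoly x y).coeff 1 := by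
  have : oppositePoly y x = (oppositePoly x y).comp (-X) := by
    have h1 : ∀ i, (-X + C (x i)) = (-1) * (X - C (x i)) := fun i => by ring
    have h2 : ∀ i, (-X - C (y i)) = (-1) * (X + C (y i)) := fun i => by ring
    simp only [oppositePoly, mul_comp, Polynomial.prod_comp, add_comp, sub_comp, X_comp, C_comp, h1, h2,
      prod_mul_distrib, prod_const]
    rw [mul_mul_mul_comm, ← mul_pow]
    simp [mul_comm]
  rw [this, coeff_comp_neg_X]
  simp

open Finset in
/-- If `n` odd power sums of two `n`-tuples agree and the first has no two entries with sum zero,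
then every entry of the first is an entry of the second. -/
theorem exists_eq_of_oddPowerSums_eq {n : ℕ} (x y : Fin n → ℤ)
    (hx : ∀ i j, i ≠ j → x i + x j ≠ 0)
    (h : ∀ j < n, ∑ i, x i ^ (2 * j + 1) = ∑ i, y i ^ (2 * j + 1)) (i : Fin n) :
    ∃ j, x i = y j := by
  have h1 := prod_add_mul_prod_sub_eq_coeff x y (fun j hj => h j (by omega)) i
  -- With n equations the coefficient of X vanishes too.
  rw [show 1 = 2 * 0 + 1 from rfl,
    oppositePoly_coeff_odd x y h (by have := i.2; omega) (by have := i.2; omega)] at h1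
  rcases mul_eq_zero.mp h1 with h2 | h2
  · obtain ⟨j, hj, hj'⟩ := prod_eq_zero_iff.mp h2
    exact absurd hj' (hx i j (ne_of_mem_erase hj).symm)
  · obtain ⟨j, -, hj⟩ := prod_eq_zero_iff.mp h2
    exact ⟨j, sub_eq_zero.mp hj⟩

open Finset in
/-- If `n - 1` odd power sums of two `n`-tuples agree and the first has no two entries with sum
zero, then either its entries are among those of the second, or the sums of two of its entries
divide a number depending on the second only. -/
theorem exists_eq_or_dvd_of_oddPowerSums_eq {n : ℕ} (x y : Fin n → ℤ)
    (hx : ∀ i j, i ≠ j → x i + x j ≠ 0)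
    (h : ∀ j < n - 1, ∑ i, x i ^ (2 * j + 1) = ∑ i, y i ^ (2 * j + 1)) :
    (∀ i, ∃ j, x i = y j) ∨
      ∀ i j, i ≠ j → x i + x j ∣ ∏ a, ∏ b ∈ univ.erase a, (y a + y b) := by
  have h1 := prod_add_mul_prod_sub_eq_coeff x y h
  have h2 := prod_add_mul_prod_sub_eq_coeff y x (fun j hj => (h j hj).symm)
  rw [oppositePoly_coeff_one_swap] at h2
  set e := (oppositePoly x y).coeff 1
  by_cases he : e = 0
  · left
    intro i
    have h3 := h1 i
    rw [he] at h3
    rcases mul_eq_zero.mp h3 with h2 | h2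
    · obtain ⟨j, hj, hj'⟩ := prod_eq_zero_iff.mp h2
      exact absurd hj' (hx i j (ne_of_mem_erase hj).symm)
    · obtain ⟨j, -, hj⟩ := prod_eq_zero_iff.mp h2
      exact ⟨j, sub_eq_zero.mp hj⟩
  · right
    have hX : (∏ a, ∏ b ∈ univ.erase a, (x a + x b)) * ∏ a, ∏ b, (x a - y b) = e ^ n := by
      rw [← prod_mul_distrib, prod_congr rfl fun a _ => h1 a]
      simp
    have hY : (∏ a, ∏ b ∈ univ.erase a, (y a + y b)) * ∏ a, ∏ b, (y a - x b) = (-e) ^ n := by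
      rw [← prod_mul_distrib, prod_congr rfl fun a _ => h2 a]
      simp
    -- The two products of differences agree up to sign and are nonzero, so they cancel between `hX`
    -- and `hY`.
    have hD : |∏ a, ∏ b, (y a - x b)| = |∏ a, ∏ b, (x a - y b)| := by
      rw [prod_comm]
      simp only [abs_prod, abs_sub_comm]
    have hD0 : |∏ a, ∏ b, (x a - y b)| ≠ 0 := by
      rw [Ne, abs_eq_zero]
      exact right_ne_zero_of_mul (hX ▸ pow_ne_zero n he)
    have hN : |∏ a, ∏ b ∈ univ.erase a, (x a + x b)| = |∏ a, ∏ b ∈ univ.erase a, (y a + y b)| := by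
      have hX' := congrArg abs hX
      have hY' := congrArg abs hY
      rw [abs_mul, abs_pow] at hX' hY'
      rw [abs_neg, hD, ← hX'] at hY'
      exact (mul_right_cancel₀ hD0 hY').symm
    intro i j hij
    rw [← dvd_abs, ← hN, dvd_abs]
    exact (dvd_prod_of_mem (fun b => x i + x b) (mem_erase.mpr ⟨hij.symm, mem_univ j⟩)).trans
      (dvd_prod_of_mem (fun a => ∏ b ∈ univ.erase a, (x a + x b)) (mem_univ i))

/-! ### The divisor bound -/

open Finset in
/-- The divisor bound: the number of divisors of `n` is `O(n ^ ε)`. -/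
theorem exists_card_divisors_le_rpow (ε : ℝ) (hε : 0 < ε) :
    ∃ C : ℝ, 0 < C ∧ ∀ n : ℕ, n ≠ 0 → (#n.divisors : ℝ) ≤ C * (n : ℝ) ^ ε := by
  obtain ⟨T, hT⟩ := exists_nat_ge ((2 : ℝ) ^ (1 / ε))
  have hl : 0 < ε * Real.log 2 := mul_pos hε (Real.log_pos one_lt_two)
  set K : ℝ := max 1 (1 / (ε * Real.log 2))
  have hK1 : 1 ≤ K := le_max_left _ _
  have hK : 1 ≤ K * (ε * Real.log 2) := by
    rw [← div_le_iff₀ hl]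
    exact le_max_right _ _
  -- For p ≥ T one has p^ε ≥ 2, so a + 1 ≤ 2^a suffices. Each of the fewer than or equal to T
  -- smaller primes costs a factor K.
  have key : ∀ p : ℕ, p.Prime → ∀ a : ℕ,
      ((a + 1 : ℕ) : ℝ) ≤ (if p < T then K else 1) * ((p ^ a : ℕ) : ℝ) ^ ε := by
    intro p hp a
    have hp2 : (2 : ℝ) ≤ p := by exact_mod_cast hp.two_le
    have hpa : ((p ^ a : ℕ) : ℝ) ^ ε = ((p : ℝ) ^ ε) ^ a := by
      rw [Nat.cast_pow, ← Real.rpow_natCast, ← Real.rpow_natCast, ← Real.rpow_mul (by positivity),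
        ← Real.rpow_mul (by positivity), mul_comm]
    rw [hpa]
    split_ifs with hpT
    · have h1 : 1 + (a : ℝ) * (ε * Real.log 2) ≤ ((p : ℝ) ^ ε) ^ a := by
        calc 1 + (a : ℝ) * (ε * Real.log 2) ≤ Real.exp (a * (ε * Real.log 2)) := by
              rw [add_comm]
              exact Real.add_one_le_exp _
          _ = ((2 : ℝ) ^ ε) ^ a := by
              rw [Real.exp_nat_mul, Real.rpow_def_of_pos two_pos, mul_comm ε]
          _ ≤ _ := by gcongr
      calc ((a + 1 : ℕ) : ℝ) ≤ K * (1 + (a : ℝ) * (ε * Real.log 2)) := by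
            push_cast
            nlinarith [mul_le_mul_of_nonneg_left hK (Nat.cast_nonneg (α := ℝ) a)]
        _ ≤ _ := by gcongr
    · rw [one_mul]
      have h2 : (2 : ℝ) ≤ (p : ℝ) ^ ε := by
        calc (2 : ℝ) = ((2 : ℝ) ^ (1 / ε)) ^ ε := by
              rw [← Real.rpow_mul (by positivity), one_div_mul_cancel hε.ne', Real.rpow_one]
          _ ≤ (p : ℝ) ^ ε := by
              gcongr
              exact hT.trans (by exact_mod_cast not_lt.mp hpT)
      calc ((a + 1 : ℕ) : ℝ) ≤ (2 : ℝ) ^ a := by exact_mod_cast Nat.lt_two_pow_self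
        _ ≤ _ := by gcongr
  refine ⟨K ^ T, by positivity, fun n hn => ?_⟩
  have hprod : (n : ℝ) ^ ε = ∏ p ∈ n.primeFactors, ((p ^ n.factorization p : ℕ) : ℝ) ^ ε := by
    rw [Real.finsetProd_rpow _ _ (fun _ _ => by positivity), ← Nat.cast_prod]
    congr 2
    exact (Nat.prod_factorization_pow_eq_self hn).symm
  rw [Nat.card_divisors hn, Nat.cast_prod, hprod]
  calc ∏ p ∈ n.primeFactors, ((n.factorization p + 1 : ℕ) : ℝ)
      ≤ ∏ p ∈ n.primeFactors, ((if p < T then K else 1) *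
          ((p ^ n.factorization p : ℕ) : ℝ) ^ ε) :=
        prod_le_prod (fun _ _ => by positivity)
          fun p hp => key p (Nat.prime_of_mem_primeFactors hp) _
    _ = K ^ #{p ∈ n.primeFactors | p < T} *
          ∏ p ∈ n.primeFactors, ((p ^ n.factorization p : ℕ) : ℝ) ^ ε := by
        rw [prod_mul_distrib, prod_ite]
        simp
    _ ≤ _ := by
        gcongr ?_ * _
        · refine pow_le_pow_right₀ hK1 ?_
          calc _ ≤ #(range T) := card_le_card fun p hp => by
                simpa using (mem_filter.mp hp).2
            _ = T := card_range T

/-! ### Solutions, and inserting or removing cancelling pairs -/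

open Finset in
/-- The solutions counted by `countU`. -/
noncomputable def solU (s k P : ℕ) (h : Fin k → ℤ) : Finset (Fin s → ℤ) :=
  (Fintype.piFinset fun _ : Fin s => Finset.Icc (-(P : ℤ)) (P : ℤ)).filter
    fun x => IsOddPowerSum P h x

theorem card_solU (s k P : ℕ) (h : Fin k → ℤ) : (solU s k P h).card = countU s k P h := rfl

theorem mem_solU {s k P : ℕ} {h : Fin k → ℤ} {x : Fin s → ℤ} :
    x ∈ solU s k P h ↔ IsOddPowerSum P h x := by
  simp only [solU, Finset.mem_filter, Fintype.mem_piFinset, Finset.mem_Icc, ← abs_le,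
    and_iff_right_iff_imp]
  exact fun hx => hx.1

/-- The solutions no two of whose entries have sum zero. -/
noncomputable def noncancelU (s k P : ℕ) (h : Fin k → ℤ) : Finset (Fin s → ℤ) :=
  (solU s k P h).filter fun x => ∀ i j, i ≠ j → x i + x j ≠ 0

theorem countU_pos_iff {s k P : ℕ} {h : Fin k → ℤ} : 0 < countU s k P h ↔ HasRep P h s := by
  rw [← card_solU, Finset.card_pos]
  exact ⟨fun ⟨x, hx⟩ => ⟨x, mem_solU.mp hx⟩, fun ⟨x, hx⟩ => ⟨x, mem_solU.mpr hx⟩⟩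

theorem HasRep.succ {k P r : ℕ} {h : Fin k → ℤ} (hr : HasRep P h r) : HasRep P h (r + 1) := by
  obtain ⟨a, ha, hs⟩ := hr
  refine ⟨Fin.cons 0 a, fun i => ?_, fun j => ?_⟩
  · cases i using Fin.cases with
    | zero => simp
    | succ i => simpa using ha i
  · rw [Fin.sum_univ_succ, ← hs j]
    simp

theorem HasRep.mono {k P r s : ℕ} {h : Fin k → ℤ} (hr : HasRep P h r) (hrs : r ≤ s) :
    HasRep P h s := by
  induction s, hrs using Nat.le_induction with
  | base => exact hr
  | succ s _ ih => exact ih.succ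

theorem countU_add_two_ge (n k P : ℕ) (h : Fin k → ℤ) :
    (2 * P + 1) * countU n k P h ≤ countU (n + 2) k P h := by
  have hc : (2 * P + 1) * countU n k P h =
      ((Finset.Icc (-(P : ℤ)) P) ×ˢ solU n k P h).card := by
    rw [Finset.card_product, card_solU, Int.card_Icc]
    congr 1
    omega
  rw [hc, ← card_solU (n + 2)]
  refine Finset.card_le_card_of_injOn
    (fun p => (Fin.cons p.1 (Fin.cons (-p.1) p.2 : Fin (n + 1) → ℤ) : Fin (n + 2) → ℤ)) ?_ ?_
  · rintro ⟨a, w⟩ hp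
    simp only [Finset.coe_product, Set.mem_prod, Finset.mem_coe, Finset.mem_Icc, mem_solU] at hp
    simp only [Finset.mem_coe, mem_solU]
    refine ⟨fun i => ?_, fun j => ?_⟩
    · cases i using Fin.cases with
      | zero => simpa [abs_le] using hp.1
      | succ i =>
        cases i using Fin.cases with
        | zero => simpa [abs_le, neg_le, and_comm] using hp.1
        | succ i => simpa using hp.2.1 i
    · rw [Fin.sum_univ_succ, Fin.sum_univ_succ, ← hp.2.2 j]
      simp [(odd_two_mul_add_one (j : ℕ)).neg_pow]
  · rintro ⟨a, w⟩ - ⟨b, v⟩ - hp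
    simp only [Fin.cons_inj] at hp
    rw [hp.1, hp.2.2]

/-- A solution with a cancelling pair is recovered from the two ordered positions, the value at the
first, and the remaining n entries, which again form a solution. -/
theorem countU_add_two_le (n k P : ℕ) (h : Fin k → ℤ) :
    countU (n + 2) k P h ≤ (noncancelU (n + 2) k P h).card +
      (n + 2) * (n + 1) * (2 * P + 1) * countU n k P h := by
  classical
  have hc : (n + 2) * (n + 1) * (2 * P + 1) * countU n k P h =
      ((Finset.univ : Finset (Fin (n + 2) × Fin (n + 1))) ×ˢ
        ((Finset.Icc (-(P : ℤ)) P) ×ˢ solU n k P h)).card := by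
    rw [Finset.card_product, Finset.card_product, card_solU, Int.card_Icc, Finset.card_univ,
      Fintype.card_prod, Fintype.card_fin, Fintype.card_fin, ← mul_assoc]
    congr 2
    omega
  rw [hc, ← card_solU (n + 2)]
  refine le_trans (Finset.card_le_card fun x hx => ?_)
    ((Finset.card_union_le _ _).trans (Nat.add_le_add_left (Finset.card_image_le
      (f := fun p : (Fin (n + 2) × Fin (n + 1)) × ℤ × (Fin n → ℤ) =>
        (Fin.insertNth p.1.1 p.2.1 (Fin.insertNth p.1.2 (-p.2.1) p.2.2 : Fin (n + 1) → ℤ) :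
          Fin (n + 2) → ℤ))) _))
  rw [Finset.mem_union]
  by_cases hnc : ∀ i j, i ≠ j → x i + x j ≠ 0
  · exact Or.inl (Finset.mem_filter.mpr ⟨hx, hnc⟩)
  · right
    push Not at hnc
    obtain ⟨p, q, hpq, hsum⟩ := hnc
    obtain ⟨q, rfl⟩ := Fin.exists_succAbove_eq hpq.symm
    have hx' := mem_solU.mp hx
    refine Finset.mem_image.mpr ⟨⟨⟨p, q⟩, x p, q.removeNth (p.removeNth x)⟩, ?_, ?_⟩
    · simp only [Finset.mem_product, Finset.mem_univ, true_and, Finset.mem_Icc, ← abs_le,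
        mem_solU]
      refine ⟨hx'.1 p, fun i => hx'.1 _, fun j => ?_⟩
      rw [← hx'.2 j, Fin.sum_univ_succAbove _ p, Fin.sum_univ_succAbove _ q,
        eq_neg_of_add_eq_zero_right hsum, (odd_two_mul_add_one (j : ℕ)).neg_pow,
        add_neg_cancel_left]
      rfl
    · have h1 : -x p = p.removeNth x q := (eq_neg_of_add_eq_zero_right hsum).symm
      simp only
      rw [h1, Fin.insertNth_self_removeNth, Fin.insertNth_self_removeNth]

theorem noncancelU_eq_solU {n k P : ℕ} (hn : n ≤ 1) (h : Fin k → ℤ) :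
    noncancelU n k P h = solU n k P h := by
  refine Finset.filter_true_of_mem fun x _ i j hij => ?_
  exact absurd (Fin.ext (by omega)) hij

/-! ### Counting noncancelling solutions -/

open Finset in
theorem exists_card_noncancelU_le {n k P : ℕ} (hk : 2 ≤ k) (hn : n ≤ k + 1) (hP : 1 ≤ P)
    (h : Fin k → ℤ) : ∃ N : ℕ, N ≠ 0 ∧ N ≤ (2 * P) ^ (n * n) ∧
      #(noncancelU n k P h) ≤ (n + (2 * #N.divisors) ^ 3) ^ n := by
  classical
  rcases (noncancelU n k P h).eq_empty_or_nonempty with he | ⟨y, hy⟩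
  · exact ⟨1, one_ne_zero, Nat.one_le_pow _ _ (by omega), by simp [he]⟩
  obtain ⟨hy, hyn⟩ := mem_filter.mp hy
  have hys := mem_solU.mp hy
  set M : ℤ := ∏ a, ∏ b ∈ univ.erase a, (y a + y b)
  have hM : M ≠ 0 := prod_ne_zero_iff.mpr fun a _ => prod_ne_zero_iff.mpr fun b hb =>
    hyn a b (ne_of_mem_erase hb).symm
  have hMle : |M| ≤ (2 * (P : ℤ)) ^ (n * n) := by
    have h1 : ∀ a, |∏ b ∈ univ.erase a, (y a + y b)| ≤ (2 * (P : ℤ)) ^ n := fun a => by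
      rw [abs_prod]
      refine (prod_le_prod (g := fun _ => 2 * (P : ℤ)) (fun _ _ => abs_nonneg _)
        fun b _ => ?_).trans ?_
      · have := abs_add_le (y a) (y b)
        have := hys.1 a
        have := hys.1 b
        omega
      · rw [prod_const]
        refine pow_le_pow_right₀ (by omega) ?_
        exact (card_le_univ _).trans_eq (Fintype.card_fin n)
    rw [abs_prod, pow_mul]
    calc _ ≤ ∏ _a : Fin n, (2 * (P : ℤ)) ^ n := prod_le_prod (fun _ _ => abs_nonneg _) fun a _ => h1 a
      _ = _ := by simp
  refine ⟨M.natAbs, Int.natAbs_ne_zero.mpr hM, by zify; exact hMle, ?_⟩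
  set D : Finset ℤ := M.natAbs.divisors.image (fun d : ℕ => (d : ℤ)) ∪
    M.natAbs.divisors.image (fun d : ℕ => -(d : ℤ))
  have hD : #D ≤ 2 * #M.natAbs.divisors := by
    rw [two_mul]
    exact (card_union_le _ _).trans (Nat.add_le_add card_image_le card_image_le)
  have hmemD : ∀ d : ℤ, d ∣ M → d ∈ D := by
    intro d hd
    have hd' : d.natAbs ∈ M.natAbs.divisors :=
      Nat.mem_divisors.mpr ⟨Int.natAbs_dvd_natAbs.mpr hd, Int.natAbs_ne_zero.mpr hM⟩
    rcases Int.natAbs_eq d with h1 | h1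
    · exact mem_union_left _ (mem_image.mpr ⟨_, hd', h1.symm⟩)
    · exact mem_union_right _ (mem_image.mpr ⟨_, hd', h1.symm⟩)
  -- The second set catches x_i through 2x_i = (x_i + x_j) + (x_i + x_l) - (x_j + x_l).
  set S : Finset ℤ := univ.image y ∪
    (D ×ˢ D ×ˢ D).image fun p => (p.1 + p.2.1 - p.2.2) / 2
  have hS : #S ≤ n + (2 * #M.natAbs.divisors) ^ 3 := by
    refine (card_union_le _ _).trans (Nat.add_le_add ?_ ?_)
    · exact card_image_le.trans_eq (by simp)
    · refine card_image_le.trans ?_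
      rw [card_product, card_product, ← pow_two, ← pow_succ']
      exact Nat.pow_le_pow_left hD 3
  have hsub : noncancelU n k P h ⊆ Fintype.piFinset fun _ : Fin n => S := by
    intro x hx
    obtain ⟨hx, hxn⟩ := mem_filter.mp hx
    have hxs := mem_solU.mp hx
    have hpow : ∀ j < k, ∑ i, x i ^ (2 * j + 1) = ∑ i, y i ^ (2 * j + 1) := fun j hj =>
      (hxs.2 ⟨j, hj⟩).trans (hys.2 ⟨j, hj⟩).symm
    have hleft : (∀ i, ∃ j, x i = y j) → x ∈ Fintype.piFinset fun _ : Fin n => S := by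
      intro hxy
      refine Fintype.mem_piFinset.mpr fun i => mem_union_left _ ?_
      obtain ⟨j, hj⟩ := hxy i
      exact mem_image.mpr ⟨j, mem_univ j, hj.symm⟩
    rcases Nat.lt_or_ge k n with hkn | hkn
    · rcases exists_eq_or_dvd_of_oddPowerSums_eq x y hxn (fun j hj => hpow j (by omega)) with
        hxy | hdvd
      · exact hleft hxy
      · refine Fintype.mem_piFinset.mpr fun i => mem_union_right _ ?_
        -- Two further indices exist because n > k ≥ 2.
        obtain ⟨j, hj, l, hl, hjl⟩ : ∃ j ∈ univ.erase i, ∃ l ∈ univ.erase i, j ≠ l := by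
          refine one_lt_card.mp ?_
          rw [card_erase_of_mem (mem_univ i), card_univ, Fintype.card_fin]
          omega
        refine mem_image.mpr ⟨(x i + x j, x i + x l, x j + x l), ?_, ?_⟩
        · simp only [mem_product]
          exact ⟨hmemD _ (hdvd i j (ne_of_mem_erase hj).symm),
            hmemD _ (hdvd i l (ne_of_mem_erase hl).symm), hmemD _ (hdvd j l hjl)⟩
        · simp only
          omega
    · exact hleft (exists_eq_of_oddPowerSums_eq x y hxn fun j hj => hpow j (by omega))
  calc _ ≤ _ := card_le_card hsub
    _ = #S ^ n := by simp
    _ ≤ _ := Nat.pow_le_pow_left hS n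

theorem exists_card_noncancelU_le_rpow (k : ℕ) (hk : 2 ≤ k) (ε : ℝ) (hε : 0 < ε) :
    ∃ C : ℝ, 1 ≤ C ∧ ∀ n ≤ k + 1, ∀ P : ℕ, 1 ≤ P → ∀ h : Fin k → ℤ,
      ((noncancelU n k P h).card : ℝ) ≤ C * (P : ℝ) ^ ε := by
  set m : ℕ := k + 1
  have hm : 0 < (m : ℝ) := by positivity
  -- The exponent absorbs N ≤ (2P)^(m²), the cube from three divisors, and the m-th power from the
  -- entries.
  obtain ⟨C, hC, hdiv⟩ := exists_card_divisors_le_rpow (ε / (m * m * 3 * m)) (by positivity)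
  refine ⟨((m + (2 * C) ^ 3) * (2 : ℝ) ^ (ε / m)) ^ m, ?_, ?_⟩
  · refine one_le_pow₀ (one_le_mul_of_one_le_of_one_le ?_ ?_)
    · have : (1 : ℝ) ≤ m := by simp [m]
      have : 0 < (2 * C) ^ 3 := by positivity
      linarith
    · exact Real.one_le_rpow one_le_two (by positivity)
  · intro n hn P hP h
    obtain ⟨N, hN0, hN, hcard⟩ := exists_card_noncancelU_le hk hn hP h
    have hP' : (1 : ℝ) ≤ P := by exact_mod_cast hP
    have hd : ((N.divisors.card : ℕ) : ℝ) ≤ C * (2 * (P : ℝ)) ^ (ε / (3 * m)) := by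
      refine (hdiv N hN0).trans ?_
      gcongr
      have hN' : (N : ℝ) ≤ (2 * (P : ℝ)) ^ (m * m) := by
        calc (N : ℝ) ≤ (2 * (P : ℝ)) ^ (n * n) := by exact_mod_cast hN
          _ ≤ _ := by
            gcongr
            linarith
      calc (N : ℝ) ^ (ε / (m * m * 3 * m))
          ≤ ((2 * (P : ℝ)) ^ (m * m)) ^ (ε / (m * m * 3 * m)) := by gcongr
        _ = (2 * (P : ℝ)) ^ (ε / (3 * m)) := by
          rw [← Real.rpow_natCast, ← Real.rpow_mul (by positivity)]
          congr 1
          push_cast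
          field_simp
    have h1 : (1 : ℝ) ≤ (2 * (P : ℝ)) ^ (ε / m) := Real.one_le_rpow (by linarith) (by positivity)
    have hbase : ((n + (2 * N.divisors.card) ^ 3 : ℕ) : ℝ) ≤
        (m + (2 * C) ^ 3) * (2 * (P : ℝ)) ^ (ε / m) := by
      have h3 : ((2 * (P : ℝ)) ^ (ε / (3 * m))) ^ 3 = (2 * (P : ℝ)) ^ (ε / m) := by
        rw [← Real.rpow_natCast, ← Real.rpow_mul (by positivity)]
        congr 1
        push_cast
        field_simp
      push_cast
      calc (n : ℝ) + (2 * N.divisors.card) ^ 3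
          ≤ m * 1 + (2 * (C * (2 * (P : ℝ)) ^ (ε / (3 * m)))) ^ 3 := by
            rw [mul_one]
            gcongr
        _ = m * 1 + (2 * C) ^ 3 * (2 * (P : ℝ)) ^ (ε / m) := by
            rw [← h3]
            ring
        _ ≤ m * (2 * (P : ℝ)) ^ (ε / m) + (2 * C) ^ 3 * (2 * (P : ℝ)) ^ (ε / m) := by gcongr
        _ = _ := by ring
    have hge : 1 ≤ (m + (2 * C) ^ 3) * (2 * (P : ℝ)) ^ (ε / m) := by
      refine one_le_mul_of_one_le_of_one_le ?_ h1
      have : (1 : ℝ) ≤ m := by simp [m]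
      have : 0 < (2 * C) ^ 3 := by positivity
      linarith
    calc ((noncancelU n k P h).card : ℝ)
        ≤ ((n + (2 * N.divisors.card) ^ 3 : ℕ) : ℝ) ^ n := by exact_mod_cast hcard
      _ ≤ ((m + (2 * C) ^ 3) * (2 * (P : ℝ)) ^ (ε / m)) ^ n := by gcongr
      _ ≤ ((m + (2 * C) ^ 3) * (2 * (P : ℝ)) ^ (ε / m)) ^ m := by gcongr
      _ = _ := by
        rw [Real.mul_rpow zero_le_two (by positivity), ← mul_assoc, mul_pow _ ((P : ℝ) ^ (ε / m)),
          ← Real.rpow_natCast ((P : ℝ) ^ (ε / m)), ← Real.rpow_mul (by positivity),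
          div_mul_cancel₀ _ hm.ne']

/-! ### Recursion on the number of variables and the theorem -/

theorem hasRep_iff_rZero_le {k P : ℕ} {h : Fin k → ℤ} (hr : ∃ r, HasRep P h r) {n : ℕ} :
    HasRep P h n ↔ rZero P h ≤ n :=
  ⟨fun hn => Nat.sInf_le hn, fun hn => (Nat.sInf_mem (s := {r | HasRep P h r}) hr).mono hn⟩

/-- Each removal of a pair costs at most a factor of the base. Once n < r₀ no solution in n
variables is left, which matches the truncated subtraction in the exponent. -/
theorem countU_le_of_noncancelU_le {k P : ℕ} {h : Fin k → ℤ} (hr : ∃ r, HasRep P h r) (B : ℝ)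
    (hB : ∀ n ≤ k + 1, ((noncancelU n k P h).card : ℝ) ≤ B) :
    ∀ n ≤ k + 1, (countU n k P h : ℝ) ≤
      B * (1 + (k + 1) * (k + 1) * (2 * P + 1)) ^ ((n - rZero P h) / 2)
  | 0, hn => by
    rw [← card_solU, ← noncancelU_eq_solU (by omega)]
    simpa using hB 0 hn
  | 1, hn => by
    rw [← card_solU, ← noncancelU_eq_solU (by omega), show (1 - rZero P h) / 2 = 0 by omega]
    simpa using hB 1 hn
  | n + 2, hn => by
    have ih := countU_le_of_noncancelU_le hr B hB n (by omega)
    have hB0 : 0 ≤ B := (Nat.cast_nonneg _).trans (hB 0 (by omega))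
    set M : ℝ := 1 + (k + 1) * (k + 1) * (2 * P + 1) with hM
    have hM1 : 1 ≤ M := le_add_of_nonneg_right (by positivity)
    have hstep : (countU (n + 2) k P h : ℝ) ≤ B + (M - 1) * countU n k P h := by
      have h1 : (countU (n + 2) k P h : ℝ) ≤ (noncancelU (n + 2) k P h).card +
          (n + 2) * (n + 1) * (2 * P + 1) * countU n k P h := by
        exact_mod_cast countU_add_two_le n k P h
      have hn' : ((n : ℝ) + 2) ≤ k + 1 := by exact_mod_cast hn
      calc _ ≤ _ := h1
        _ ≤ B + (k + 1) * (k + 1) * (2 * P + 1) * countU n k P h := by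
          gcongr
          · exact hB _ hn
          · linarith
        _ = _ := by rw [hM]; ring
    by_cases hrn : rZero P h ≤ n
    · rw [show (n + 2 - rZero P h) / 2 = (n - rZero P h) / 2 + 1 by omega]
      have h2 : 1 ≤ M ^ ((n - rZero P h) / 2) := one_le_pow₀ hM1
      calc _ ≤ _ := hstep
        _ ≤ B * M ^ ((n - rZero P h) / 2) + (M - 1) * (B * M ^ ((n - rZero P h) / 2)) := by
          have : 0 ≤ M - 1 := by linarith
          gcongr
          exact le_mul_of_one_le_right hB0 h2
        _ = _ := by ring
    · have h0 : countU n k P h = 0 := by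
        by_contra hne
        exact hrn ((hasRep_iff_rZero_le hr).mp (countU_pos_iff.mp (Nat.pos_of_ne_zero hne)))
      rw [h0, Nat.cast_zero, mul_zero, add_zero] at hstep
      exact hstep.trans (le_mul_of_one_le_right hB0 (one_le_pow₀ hM1))

theorem pow_le_countU {k P n : ℕ} {h : Fin k → ℤ} (hr : HasRep P h n) :
    ∀ e : ℕ, P ^ e ≤ countU (n + 2 * e) k P h
  | 0 => by simpa using Nat.one_le_iff_ne_zero.mpr (countU_pos_iff.mpr hr).ne'
  | e + 1 => by
    calc P ^ (e + 1) = P * P ^ e := pow_succ' _ _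
      _ ≤ (2 * P + 1) * countU (n + 2 * e) k P h :=
        Nat.mul_le_mul (by omega) (pow_le_countU hr e)
      _ ≤ _ := countU_add_two_ge _ _ _ _

theorem tauExp_eq {k P : ℕ} {h : Fin k → ℤ} (hr : rZero P h ≤ k + 1) :
    tauExp P h = ((k + 1 - rZero P h) / 2 : ℕ) := by
  rw [tauExp, ← Int.natCast_floor_eq_floor (by
    have : (rZero P h : ℚ) ≤ k + 1 := by exact_mod_cast hr
    apply div_nonneg <;> linarith)]
  congr 1
  rw [← Nat.floor_div_eq_div (K := ℚ)]
  push_cast [hr]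
  rfl

theorem theorem1p6 (k : ℕ) (hk : 2 ≤ k) :
    ∃ P₀ : ℕ,
      (∀ P : ℕ, P₀ ≤ P → ∀ h : Fin k → ℤ, h ≠ 0 → (∃ r : ℕ, HasRep P h r) →
        rZero P h ≤ k + 1 →
          (P : ℝ) ^ (tauExp P h) ≤ (countU (k + 1) k P h : ℝ)) ∧
      (∀ ε : ℝ, 0 < ε → ∃ C : ℝ, 0 < C ∧
        ∀ P : ℕ, P₀ ≤ P → ∀ h : Fin k → ℤ, h ≠ 0 → (∃ r : ℕ, HasRep P h r) →
          (countU (k + 1) k P h : ℝ) ≤ C * (P : ℝ) ^ ((tauExp P h : ℝ) + ε)) := by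
  refine ⟨1, fun P _ h _ hr hrk => ?_, fun ε hε => ?_⟩
  · rw [tauExp_eq hrk, zpow_natCast]
    -- This length is r₀ or r₀ + 1, by parity; a zero entry pads the latter.
    have h1 : HasRep P h (k + 1 - 2 * ((k + 1 - rZero P h) / 2)) :=
      (hasRep_iff_rZero_le hr).mpr (by omega)
    have h2 := pow_le_countU h1 ((k + 1 - rZero P h) / 2)
    rw [Nat.sub_add_cancel (by omega)] at h2
    exact_mod_cast h2
  · obtain ⟨C, hC, hV⟩ := exists_card_noncancelU_le_rpow k hk ε hε
    -- For P ≥ 1, 1 + (k + 1)²(2P + 1) ≤ A P.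
    set A : ℝ := 4 * ((k + 1) * (k + 1))
    have hk1 : (1 : ℝ) ≤ (k + 1) * (k + 1) := by
      have : (0 : ℝ) ≤ k := Nat.cast_nonneg k
      nlinarith
    have hA : 1 ≤ A := by linarith
    refine ⟨C * A ^ (k + 1), by positivity, fun P hP h _ hr => ?_⟩
    have hP' : (1 : ℝ) ≤ P := by exact_mod_cast hP
    by_cases hrk : rZero P h ≤ k + 1
    · have h1 := countU_le_of_noncancelU_le hr _ (fun n hn => hV n hn P hP h) (k + 1) le_rfl
      rw [tauExp_eq hrk]
      set e := (k + 1 - rZero P h) / 2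
      calc _ ≤ _ := h1
        _ ≤ C * (P : ℝ) ^ ε * (A * P) ^ e := by
          gcongr
          nlinarith
        _ = C * A ^ e * ((P : ℝ) ^ ε * (P : ℝ) ^ e) := by
          rw [mul_pow]
          ring
        -- This frees the constant from `e`, hence from P and h.
        _ ≤ C * A ^ (k + 1) * ((P : ℝ) ^ ε * (P : ℝ) ^ e) := by
          have : e ≤ k + 1 := by omega
          gcongr
        _ = _ := by
          rw [Real.rpow_add (by linarith), Int.cast_natCast, Real.rpow_natCast,
            mul_comm ((P : ℝ) ^ ε)]
    · have h0 : countU (k + 1) k P h = 0 := by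
        by_contra hne
        exact hrk ((hasRep_iff_rZero_le hr).mp (countU_pos_iff.mp (Nat.pos_of_ne_zero hne)))
      rw [h0, Nat.cast_zero]
      positivity
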